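/- For $\tau$ in the upper half-plane let $q=e^{2\pi i\tau}$, let $\eta(\tau)=q^{1/24}\prod_{n\ge1}(1-q^n)$, and put $$\Phi_2(q)=\frac{\eta(2\tau)}{\eta(\tau)^2},\qquad G_2(q)=\left(\frac{\eta(2\tau)}{\eta(\tau)}\right)^{24},\qquad G_8=G_8(q)=\frac{\eta(8\tau)^4\,\eta(2\tau)^2}{\eta(4\tau)^2\,\eta(\tau)^4},$$ regarded as power series in $q$ with integer coefficients. Let $U_2$ be the operator $\left(\sum_{n\ge0}a(n)q^n\right)\big|U_2=\sum_{n\ge0}a(2n)q^n$. For $s\ge1$ define $L_1^s=\left(\Phi_2(-q)\,G_2(-q)^s\right)|U_2$ and $L_\alpha^s=L_{\alpha-1}^s|U_2$ for $\alpha\ge2$. Let $\pi_2$ denote the $2$-adic valuation on $\mathbb{Z}$, with $\pi_2(0)=\infty$. Theorem. For all integers $s\ge1$ and $\alpha\ge1$ there are unique integers $c_{\alpha j}^s$ and $b_{\alpha j}^s$ ($j\ge1$) such that $$L_{2\alpha-1}^s=\Phi_2(-q^2)\sum_{j=1}^\infty c_{\alpha j}^s\,G_8^j,\qquad L_{2\alpha}^s=\Phi_2(-q)\sum_{j=1}^\infty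 b_{\alpha j}^s\,G_8^j,$$ and for all $j\ge1$ they satisfy $$\pi_2(c_{\alpha j}^s)\ge 2\alpha+2j-s-2,\qquad \pi_2(b_{\alpha j}^s)\ge 2\alpha+2j-s-1.$$ -/

import Mathlib

open PowerSeries
open scoped PowerSeries.WithPiTopology

namespace EtaU2

noncomputable section

/-- The Euler product `E(q) = ∏_{n ≥ 1} (1 - q ^ n)`, as a formal power series in `q = X`.
The infinite product is taken in the coefficientwise topology on `ℤ⟦X⟧` (`ℤ` is discrete),
where it converges. -/
def euler : ℤ⟦X⟧ := ∏' n : ℕ, ((1 : ℤ⟦X⟧) - X ^ (n + 1))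

/-- `E(q ^ δ) = ∏_{n ≥ 1} (1 - q ^ (δ n))`, so that `η(δτ) = q ^ (δ / 24) * E(q ^ δ)`
for `q = e ^ (2πiτ)`. -/
def eulerAt (δ : ℕ) [NeZero δ] : ℤ⟦X⟧ := expand δ (NeZero.ne δ) euler

/-- The inverse of `eulerAt δ` in `ℤ⟦X⟧` (its constant coefficient is `1`). -/
def eulerInv (δ : ℕ) [NeZero δ] : ℤ⟦X⟧ := invOfUnit (eulerAt δ) 1

/-- `Φ₂(q) = η(2τ) / η(τ)²`; the exponents of `q ^ (1/24)` add up to `2 - 2 * 1 = 0`. -/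
def Phi2 : ℤ⟦X⟧ := eulerAt 2 * eulerInv 1 ^ 2

/-- `G₂(q) = (η(2τ) / η(τ))²⁴`; the exponents of `q ^ (1/24)` add up to `24`,
which is the factor `q = X`. -/
def G2 : ℤ⟦X⟧ := X * (eulerAt 2 * eulerInv 1) ^ 24

/-- `G₈(q) = η(8τ)⁴ η(2τ)² / (η(4τ)² η(τ)⁴)`; the exponents of `q ^ (1/24)` add up to
`32 + 4 - 8 - 4 = 24`, which is the factor `q = X`. -/
def G8 : ℤ⟦X⟧ := X * (eulerAt 8 ^ 4 * eulerAt 2 ^ 2 * eulerInv 4 ^ 2 * eulerInv 1 ^ 4)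

/-- `F(q) ↦ F(-q)`. -/
def negArg (F : ℤ⟦X⟧) : ℤ⟦X⟧ := evalNegHom F

/-- `F(q) ↦ F(q²)`. -/
def sqArg (F : ℤ⟦X⟧) : ℤ⟦X⟧ := expand 2 two_ne_zero F

/-- The Atkin operator `U₂ : ∑ a(n) q ^ n ↦ ∑ a(2 n) q ^ n`. -/
def U2 (F : ℤ⟦X⟧) : ℤ⟦X⟧ := PowerSeries.mk fun n => coeff (2 * n) F

/-- `L_α^s`, the result of applying `U₂` to `Φ₂(-q) G₂(-q) ^ s` exactly `α` times. -/
def L (s α : ℕ) : ℤ⟦X⟧ := U2^[α] (negArg Phi2 * negArg G2 ^ s)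

/-- `F = P * ∑_{j ≥ 1} c_j G₈ ^ j`, where the series converges coefficientwise. -/
def HasG8Expansion (F P : ℤ⟦X⟧) (c : ℕ+ → ℤ) : Prop :=
  ∃ S : ℤ⟦X⟧, HasSum (fun j : ℕ+ => c j • G8 ^ (j : ℕ)) S ∧ F = P * S

/-- `m ≤ π₂(n)`, where `π₂` is the 2-adic valuation on `ℤ` with `π₂(0) = ∞`. -/
def LePi2 (m n : ℤ) : Prop := n ≠ 0 → m ≤ (padicValInt 2 n : ℤ)

end

end EtaU2

namespace EtaU2

section Gauss

variable {R : Type*} [CommRing R] (q : R)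

theorem gauss_telescope (n m : ℕ) (hm : m ≤ n) :
    ∑ i ∈ Finset.range m, (-1) ^ (i + 1) * (∏ j ∈ Finset.range i, (1 + q ^ (j + 1))) *
        ((∏ j ∈ Finset.Ico (i + 1) (n + 1), (1 - q ^ (j + 1))) * q ^ ((i + 1) * (n + 2)) -
          (1 + q ^ (n + 1)) *
            ((∏ j ∈ Finset.Ico (i + 1) n, (1 - q ^ (j + 1))) * q ^ ((i + 1) * (n + 1)))) =
      q ^ (n + 1) * ∏ j ∈ Finset.Ico 0 n, (1 - q ^ (j + 1)) -
        (-1) ^ m * q ^ ((m + 1) * (n + 1)) * (∏ j ∈ Finset.range m, (1 + q ^ (j + 1))) *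
          ∏ j ∈ Finset.Ico m n, (1 - q ^ (j + 1)) := by
  induction m with
  | zero => simp
  | succ m ih =>
    rw [Finset.sum_range_succ, ih (by omega), Finset.prod_range_succ,
      Finset.prod_Ico_succ_top (by omega : m + 1 ≤ n),
      Finset.prod_eq_prod_Ico_succ_bot (by omega : m < n)]
    ring

theorem gauss_finite (n : ℕ) :
    (1 + 2 * ∑ i ∈ Finset.range n, (-1) ^ (i + 1) * q ^ ((i + 1) ^ 2)) *
        ∏ j ∈ Finset.range n, (1 + q ^ (j + 1)) =
      ∏ j ∈ Finset.range n, (1 - q ^ (j + 1)) +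
        2 * ∑ i ∈ Finset.range n, (-1) ^ (i + 1) * (∏ j ∈ Finset.range i, (1 + q ^ (j + 1))) *
          ((∏ j ∈ Finset.Ico (i + 1) n, (1 - q ^ (j + 1))) * q ^ ((i + 1) * (n + 1))) := by
  induction n with
  | zero => simp
  | succ n ih =>
    have key := gauss_telescope q n n le_rfl
    simp only [mul_sub, Finset.sum_sub_distrib, Finset.Ico_self, Finset.prod_empty] at key
    have hcomm : ∀ i, (-1) ^ (i + 1) * (∏ j ∈ Finset.range i, (1 + q ^ (j + 1))) *
        ((1 + q ^ (n + 1)) *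
            ((∏ j ∈ Finset.Ico (i + 1) n, (1 - q ^ (j + 1))) * q ^ ((i + 1) * (n + 1)))) =
        (1 + q ^ (n + 1)) * ((-1) ^ (i + 1) * (∏ j ∈ Finset.range i, (1 + q ^ (j + 1))) *
          ((∏ j ∈ Finset.Ico (i + 1) n, (1 - q ^ (j + 1))) * q ^ ((i + 1) * (n + 1)))) :=
      fun i => by ring
    simp only [hcomm, ← Finset.mul_sum, ← Finset.range_eq_Ico] at key
    rw [Finset.sum_range_succ, Finset.sum_range_succ _ n, Finset.prod_range_succ,
      Finset.prod_range_succ _ n, Finset.Ico_self, Finset.prod_empty]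
    linear_combination (1 + q ^ (n + 1)) * ih - 2 * key

end Gauss

section Products

theorem coeff_negArg (F : ℤ⟦X⟧) (n : ℕ) : coeff n (negArg F) = (-1) ^ n * coeff n F := by
  simp [negArg, evalNegHom, coeff_rescale]

theorem coeff_sqArg (F : ℤ⟦X⟧) (n : ℕ) :
    coeff n (sqArg F) = if 2 ∣ n then coeff (n / 2) F else 0 := by
  simp [sqArg, coeff_expand]

theorem coeff_two_mul_sqArg (F : ℤ⟦X⟧) (n : ℕ) : coeff (2 * n) (sqArg F) = coeff n F := by
  simp [coeff_sqArg]

/-- `F(q) ↦ F(-q)` as a ring homomorphism. -/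
noncomputable def negHom : ℤ⟦X⟧ →+* ℤ⟦X⟧ := evalNegHom

/-- `F(q) ↦ F(q²)` as a ring homomorphism. -/
noncomputable def sqHom : ℤ⟦X⟧ →+* ℤ⟦X⟧ := (expand 2 two_ne_zero : ℤ⟦X⟧ →ₐ[ℤ] ℤ⟦X⟧)

theorem negArg_eq (F : ℤ⟦X⟧) : negArg F = negHom F := rfl

theorem sqArg_eq (F : ℤ⟦X⟧) : sqArg F = sqHom F := rfl

theorem negHom_X : negHom X = -X := evalNegHom_X

theorem sqHom_X : sqHom X = X ^ 2 := expand_X 2 two_ne_zero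

theorem negHom_negHom (F : ℤ⟦X⟧) : negHom (negHom F) = F := by
  ext n
  rw [← negArg_eq, ← negArg_eq, coeff_negArg, coeff_negArg, ← mul_assoc, ← mul_pow]
  simp

theorem negHom_sqHom (F : ℤ⟦X⟧) : negHom (sqHom F) = sqHom F := by
  ext n
  rw [← negArg_eq, ← sqArg_eq, coeff_negArg, coeff_sqArg]
  split_ifs with h
  · rw [(even_iff_two_dvd.mpr h).neg_one_pow, one_mul]
  · simp

theorem constantCoeff_sqHom (F : ℤ⟦X⟧) : constantCoeff (sqHom F) = constantCoeff F :=
  constantCoeff_expand 2 two_ne_zero F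

theorem constantCoeff_negHom (F : ℤ⟦X⟧) : constantCoeff (negHom F) = constantCoeff F := by
  rw [← coeff_zero_eq_constantCoeff_apply, ← negArg_eq, coeff_negArg]
  simp

theorem continuous_sqHom : Continuous sqHom := by
  rw [continuous_iff_continuousAt]
  intro F
  rw [ContinuousAt, WithPiTopology.tendsto_iff_coeff_tendsto]
  intro n
  simp only [← sqArg_eq, coeff_sqArg]
  split_ifs
  · exact (WithPiTopology.continuous_coeff ℤ _).continuousAt
  · exact tendsto_const_nhds

theorem continuous_negHom : Continuous negHom := by
  rw [continuous_iff_continuousAt]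
  intro F
  rw [ContinuousAt, WithPiTopology.tendsto_iff_coeff_tendsto]
  intro n
  simp only [← negArg_eq, coeff_negArg]
  exact ((WithPiTopology.continuous_coeff ℤ _).const_mul _).continuousAt

theorem multipliable_one_add_of_X_pow_dvd {f : ℕ → ℤ⟦X⟧} (h : ∀ n, X ^ n ∣ f n) :
    Multipliable fun n => 1 + f n := by
  apply WithPiTopology.multipliable_one_add_of_tendsto_order_atTop_nhds_top
  refine ENat.tendsto_nhds_top_iff_natCast_lt.mpr fun n => Filter.eventually_atTop.mpr
    ⟨n + 1, fun m hm => ?_⟩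
  refine lt_of_lt_of_le (Nat.cast_lt.mpr (Nat.lt_of_succ_le hm)) ?_
  exact nat_le_order _ _ (X_pow_dvd_iff.mp (h m))

end Products

section EulerProducts

theorem multipliable_one_sub_X_pow_odd :
    Multipliable fun n : ℕ => (1 : ℤ⟦X⟧) - X ^ (2 * n + 1) := by
  simp only [sub_eq_add_neg]
  exact multipliable_one_add_of_X_pow_dvd fun n => (pow_dvd_pow X (by omega)).neg_right

theorem multipliable_one_add_X_pow : Multipliable fun n : ℕ => (1 : ℤ⟦X⟧) + X ^ (n + 1) :=
  multipliable_one_add_of_X_pow_dvd fun n => pow_dvd_pow X (by omega)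

theorem eulerAt_one : eulerAt 1 = euler := by
  simp [eulerAt]

theorem eulerAt_two : eulerAt 2 = sqHom (eulerAt 1) := by
  rw [eulerAt_one]; rfl

theorem sqHom_eulerAt (k m : ℕ) [NeZero k] [NeZero m] (h : m = 2 * k) :
    sqHom (eulerAt k) = eulerAt m := by
  subst h
  exact (expand_mul (p := 2) two_ne_zero k (NeZero.ne k) euler).symm

theorem negHom_eulerAt (k : ℕ) [NeZero k] (h : 2 ∣ k) : negHom (eulerAt k) = eulerAt k := by
  obtain ⟨m, rfl⟩ := h
  have : NeZero m := ⟨fun h => NeZero.ne (2 * m) (by simp [h])⟩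
  rw [← sqHom_eulerAt m _ rfl, negHom_sqHom]

theorem sqHom_one_sub_X_pow (n : ℕ) : sqHom (1 - X ^ n) = 1 - X ^ (2 * n) := by
  rw [map_sub, map_one, map_pow, sqHom_X, ← pow_mul]

theorem eulerAt_two_eq_tprod : eulerAt 2 = ∏' n : ℕ, ((1 : ℤ⟦X⟧) - X ^ (2 * n + 2)) := by
  rw [eulerAt_two, eulerAt_one, euler,
    (WithPiTopology.multipliable_one_sub_X_pow ℤ).map_tprod _ continuous_sqHom]
  simp only [sqHom_one_sub_X_pow, mul_add, mul_one]

theorem multipliable_one_sub_X_pow_even :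
    Multipliable fun n : ℕ => (1 : ℤ⟦X⟧) - X ^ (2 * n + 2) := by
  have := (WithPiTopology.multipliable_one_sub_X_pow ℤ).map _ continuous_sqHom
  simpa only [Function.comp_def, sqHom_one_sub_X_pow, mul_add, mul_one] using this

/-- `∏_{n ≥ 0} (1 - q ^ (2n + 1))`. -/
noncomputable def oddEuler : ℤ⟦X⟧ := ∏' n : ℕ, ((1 : ℤ⟦X⟧) - X ^ (2 * n + 1))

/-- `∏_{n ≥ 1} (1 + q ^ n)`. -/
noncomputable def eulerPlus : ℤ⟦X⟧ := ∏' n : ℕ, ((1 : ℤ⟦X⟧) + X ^ (n + 1))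

theorem oddEuler_mul : oddEuler * eulerAt 2 = eulerAt 1 := by
  rw [eulerAt_two_eq_tprod, eulerAt_one]
  exact tprod_even_mul_odd (f := fun n : ℕ => (1 : ℤ⟦X⟧) - X ^ (n + 1))
    multipliable_one_sub_X_pow_odd multipliable_one_sub_X_pow_even

theorem oddEuler_mul_negHom : oddEuler * negHom oddEuler = sqHom oddEuler := by
  have h1 := multipliable_one_sub_X_pow_odd.map _ continuous_negHom
  rw [oddEuler, multipliable_one_sub_X_pow_odd.map_tprod _ continuous_negHom,
    multipliable_one_sub_X_pow_odd.map_tprod _ continuous_sqHom,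
    ← multipliable_one_sub_X_pow_odd.tprod_mul (by exact h1)]
  congr 1
  ext1 n
  rw [sqHom_one_sub_X_pow, map_sub, map_one, map_pow, negHom_X,
    Odd.neg_pow ⟨n, rfl⟩]
  ring

theorem negHom_eulerAt_one : negHom (eulerAt 1) * eulerAt 1 * eulerAt 4 = eulerAt 2 ^ 3 := by
  have h2 : negHom (eulerAt 1) = negHom oddEuler * eulerAt 2 := by
    rw [← oddEuler_mul, map_mul, negHom_eulerAt 2 dvd_rfl]
  have h4 : eulerAt 2 = sqHom oddEuler * eulerAt 4 := by
    rw [eulerAt_two, ← oddEuler_mul, map_mul, sqHom_eulerAt 2 4 rfl]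
  rw [h2]
  linear_combination (- negHom oddEuler * eulerAt 2 * eulerAt 4) * oddEuler_mul +
    eulerAt 2 ^ 2 * eulerAt 4 * oddEuler_mul_negHom - eulerAt 2 ^ 2 * h4

theorem eulerPlus_mul : eulerPlus * eulerAt 1 = eulerAt 2 := by
  rw [eulerAt_two_eq_tprod, eulerAt_one, eulerPlus, euler,
    ← multipliable_one_add_X_pow.tprod_mul (WithPiTopology.multipliable_one_sub_X_pow ℤ)]
  congr 1
  ext1 n
  ring

end EulerProducts

section Theta

/-- Ramanujan's theta function `φ(q) = ∑ q ^ (n²)`, the sum over all integers `n`. -/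
noncomputable def theta : ℤ⟦X⟧ :=
  PowerSeries.mk fun n => if n = 0 then 1 else if IsSquare n then 2 else 0

theorem coeff_theta (n : ℕ) :
    coeff n theta = if n = 0 then 1 else if IsSquare n then 2 else 0 := coeff_mk _ _

theorem tendsto_theta :
    Filter.Tendsto (fun n => 1 + 2 * ∑ i ∈ Finset.range n, (X : ℤ⟦X⟧) ^ ((i + 1) ^ 2))
      Filter.atTop (nhds theta) := by
  rw [WithPiTopology.tendsto_iff_coeff_tendsto]
  intro d
  refine tendsto_atTop_of_eventually_const (i₀ := d) fun n hn => ?_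
  rw [show (2 : ℤ⟦X⟧) = C 2 from rfl, map_add, coeff_C_mul, map_sum, coeff_one, coeff_theta]
  simp only [coeff_X_pow]
  rcases Nat.eq_zero_or_pos d with rfl | hd
  · simp [(pow_pos (Nat.succ_pos _) 2).ne]
  rw [if_neg hd.ne', if_neg hd.ne']
  split_ifs with h
  · obtain ⟨r, rfl⟩ := h
    have hr : 0 < r := Nat.pos_of_mul_pos_left hd
    have hrr : r ≤ r * r := Nat.le_mul_self r
    rw [Finset.sum_eq_single (r - 1)]
    · rw [if_pos (by rw [Nat.sub_add_cancel hr, sq])]; rfl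
    · intro b _ hb
      rw [if_neg]
      intro h
      rw [← sq] at h
      have := Nat.pow_left_injective (two_ne_zero) h
      omega
    · intro h
      exact absurd (Finset.mem_range.mpr (by omega)) h
  · rw [Finset.sum_eq_zero]
    · simp
    · intro b _
      rw [if_neg]
      rintro rfl
      exact h ⟨b + 1, sq _⟩

theorem negHom_theta_mul_eulerPlus : negHom theta * eulerPlus = eulerAt 1 := by
  have h1 := (continuous_negHom.tendsto _).comp tendsto_theta
  have h2 := multipliable_one_add_X_pow.hasProd.tendsto_prod_nat
  have h3 := (WithPiTopology.multipliable_one_sub_X_pow ℤ).hasProd.tendsto_prod_nat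
  have h4 := (h1.mul h2).sub h3
  rw [eulerAt_one]
  refine sub_eq_zero.mp (tendsto_nhds_unique h4 ?_)
  rw [WithPiTopology.tendsto_iff_coeff_tendsto]
  intro d
  refine tendsto_atTop_of_eventually_const (i₀ := d) fun n hn => ?_
  have hneg : negHom (1 + 2 * ∑ i ∈ Finset.range n, (X : ℤ⟦X⟧) ^ ((i + 1) ^ 2)) =
      1 + 2 * ∑ i ∈ Finset.range n, (-1) ^ (i + 1) * (X : ℤ⟦X⟧) ^ ((i + 1) ^ 2) := by
    simp only [map_add, map_mul, map_one, map_ofNat, map_sum, map_pow, negHom_X]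
    congr 2
    refine Finset.sum_congr rfl fun i _ => ?_
    rw [neg_pow]
    congr 1
    rw [sq, pow_mul]
    rcases Nat.even_or_odd (i + 1) with h | h
    · simp [h.neg_one_pow]
    · simp [h.neg_one_pow]
  rw [Function.comp_apply, hneg, gauss_finite, add_sub_cancel_left, map_zero]
  refine X_pow_dvd_iff.mp (?_ : X ^ (d + 1) ∣ _) d (Nat.lt_succ_self d)
  refine Dvd.dvd.mul_left (Finset.dvd_sum fun i _ => ?_) _
  refine Dvd.dvd.mul_left (Dvd.dvd.mul_left (pow_dvd_pow X ?_) _) _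
  nlinarith

theorem negHom_theta_mul : negHom theta * eulerAt 2 = eulerAt 1 ^ 2 := by
  linear_combination eulerAt 1 * negHom_theta_mul_eulerPlus - negHom theta * eulerPlus_mul

theorem theta_mul : theta * eulerAt 2 = negHom (eulerAt 1) ^ 2 := by
  have := congrArg negHom negHom_theta_mul
  rwa [map_mul, negHom_negHom, negHom_eulerAt 2 dvd_rfl, map_pow] at this

theorem theta_add_negHom : theta + negHom theta = 2 * sqHom (sqHom theta) := by
  ext n
  rw [show (2 : ℤ⟦X⟧) = C 2 from rfl, map_add, coeff_C_mul, ← negArg_eq, coeff_negArg,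
    ← sqArg_eq, ← sqArg_eq, coeff_sqArg, coeff_sqArg]
  rcases Nat.even_or_odd n with h | h
  · rw [h.neg_one_pow, if_pos h.two_dvd]
    split_ifs with h2
    · obtain ⟨k, hk⟩ := h2
      obtain rfl : n = 4 * k := by have := h.two_dvd; omega
      rw [hk, Nat.mul_div_cancel_left _ two_pos, coeff_theta, coeff_theta]
      have : IsSquare (4 * k) ↔ IsSquare k := by
        constructor
        · rintro ⟨r, hr⟩
          have : Even r := by
            by_contra hodd
            have := (Nat.not_even_iff_odd.mp hodd).mul (Nat.not_even_iff_odd.mp hodd)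
            rw [← hr] at this
            exact absurd this (by simp [show Even 4 by decide])
          obtain ⟨t, rfl⟩ := this
          exact ⟨t, by nlinarith⟩
        · rintro ⟨t, rfl⟩
          exact ⟨2 * t, by ring⟩
      simp only [this, mul_eq_zero, OfNat.ofNat_ne_zero, false_or]
      ring
    · rw [coeff_theta, if_neg (by omega), if_neg]
      · simp
      · rintro ⟨r, rfl⟩
        have : Even r := by
          by_contra hodd
          have := (Nat.not_even_iff_odd.mp hodd).mul (Nat.not_even_iff_odd.mp hodd)
          exact absurd h (Nat.not_even_iff_odd.mpr this)
        obtain ⟨t, rfl⟩ := this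
        refine h2 ⟨t * t, ?_⟩
        rw [show (t + t) * (t + t) = 2 * (2 * (t * t)) by ring,
          Nat.mul_div_cancel_left _ two_pos]
  · rw [h.neg_one_pow, if_neg (by rwa [← even_iff_two_dvd, Nat.not_even_iff_odd])]
    ring

end Theta

section ThetaRelations

theorem eq_zero_of_eq_mul_sqHom {D : ℤ⟦X⟧} (h : D = -2 * sqHom D) : D = 0 := by
  have key : ∀ n, coeff n D = -2 * coeff n (sqHom D) := fun n => by
    conv_lhs => rw [h]
    rw [show (-2 : ℤ⟦X⟧) = C (-2) by simp, coeff_C_mul]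
  ext n
  induction n using Nat.strong_induction_on with
  | _ n ih =>
    rw [map_zero]
    have hn := key n
    rw [← sqArg_eq, coeff_sqArg] at hn
    split_ifs at hn with h2
    · rcases Nat.eq_zero_or_pos n with rfl | hpos
      · simp only [Nat.zero_div] at hn
        omega
      · rw [hn, ih (n / 2) (by omega)]
        simp
    · simpa using hn

theorem eq_of_sq_mul_sqHom {k m : ℤ⟦X⟧} (h : k ^ 2 * sqHom m = m ^ 2 * sqHom k)
    (h0 : constantCoeff k = constantCoeff m) (hm : constantCoeff m ≠ 0) : k = m := by
  by_contra hne
  have hδ : k - m ≠ 0 := sub_ne_zero.mpr hne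
  set r := (k - m).order.toNat with hr
  set ε := divXPowOrder (k - m) with hε
  have hfac : k - m = X ^ r * ε := (X_pow_order_mul_divXPowOrder).symm
  have hε0 : constantCoeff ε ≠ 0 := by
    rw [hε, constantCoeff_divXPowOrder]
    exact coeff_order hδ
  have hr0 : r ≠ 0 := by
    intro h
    rw [h, pow_zero, one_mul] at hfac
    rw [← hfac, map_sub, h0, sub_self] at hε0
    exact hε0 rfl
  have hs : sqHom k - sqHom m = X ^ r * (X ^ r * sqHom ε) := by
    rw [← map_sub, hfac, map_mul, map_pow, sqHom_X]
    ring
  have hcancel : ε * (k + m) * sqHom m = m ^ 2 * (X ^ r * sqHom ε) := by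
    refine mul_left_cancel₀ (pow_ne_zero r X_ne_zero) ?_
    linear_combination h + m ^ 2 * hs - (k + m) * sqHom m * hfac
  have := congrArg constantCoeff hcancel
  simp only [map_mul, map_add, map_pow, constantCoeff_sqHom, constantCoeff_X, h0, zero_pow hr0,
    zero_mul, mul_zero, mul_eq_zero] at this
  rcases this with (h | h) | h
  · exact hε0 h
  · omega
  · exact hm h

theorem constantCoeff_euler : constantCoeff euler = 1 := by
  rw [euler, (WithPiTopology.multipliable_one_sub_X_pow ℤ).map_tprod _
    (WithPiTopology.continuous_constantCoeff ℤ)]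
  simp

theorem constantCoeff_eulerAt (k : ℕ) [NeZero k] : constantCoeff (eulerAt k) = 1 := by
  rw [eulerAt, constantCoeff_expand, constantCoeff_euler]

theorem eulerAt_ne_zero (k : ℕ) [NeZero k] : eulerAt k ≠ 0 := fun h => by
  have := constantCoeff_eulerAt k
  simp [h] at this

theorem eulerAt_mul_eulerInv (k : ℕ) [NeZero k] : eulerAt k * eulerInv k = 1 :=
  mul_invOfUnit _ 1 (by simp [constantCoeff_eulerAt])

theorem sqHom_negHom_theta_mul : sqHom (negHom theta) * eulerAt 4 = eulerAt 2 ^ 2 := by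
  rw [← sqHom_eulerAt 2 4 rfl, ← map_mul, negHom_theta_mul, map_pow, ← eulerAt_two]

theorem theta_mul' : theta * (eulerAt 1 ^ 2 * eulerAt 4 ^ 2) = eulerAt 2 ^ 5 := by
  refine mul_right_cancel₀ (eulerAt_ne_zero 2) ?_
  linear_combination (eulerAt 1 ^ 2 * eulerAt 4 ^ 2) * theta_mul +
    (negHom (eulerAt 1) * eulerAt 1 * eulerAt 4 + eulerAt 2 ^ 3) * negHom_eulerAt_one

theorem sqHom_theta_mul' :
    sqHom theta * (eulerAt 2 ^ 2 * eulerAt 8 ^ 2) = eulerAt 4 ^ 5 := by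
  have := congrArg sqHom theta_mul'
  simpa only [map_mul, map_pow, sqHom_eulerAt 1 2 rfl, sqHom_eulerAt 2 4 rfl,
    sqHom_eulerAt 4 8 rfl] using this

theorem sqHom_sqHom_theta_mul' :
    sqHom (sqHom theta) * (eulerAt 4 ^ 2 * eulerAt 16 ^ 2) = eulerAt 8 ^ 5 := by
  have := congrArg sqHom sqHom_theta_mul'
  simpa only [map_mul, map_pow, sqHom_eulerAt 2 4 rfl, sqHom_eulerAt 4 8 rfl,
    sqHom_eulerAt 8 16 rfl] using this

theorem theta_mul_negHom : theta * negHom theta = sqHom (negHom theta) ^ 2 := by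
  refine mul_right_cancel₀ (pow_ne_zero 2 (mul_ne_zero
    (mul_ne_zero (eulerAt_ne_zero 1) (eulerAt_ne_zero 2)) (eulerAt_ne_zero 4))) ?_
  linear_combination (negHom theta * eulerAt 2 ^ 2) * theta_mul' +
    eulerAt 2 ^ 6 * negHom_theta_mul -
    (sqHom (negHom theta) * eulerAt 4 + eulerAt 2 ^ 2) * (eulerAt 1 * eulerAt 2) ^ 2 *
      sqHom_negHom_theta_mul

theorem theta_sq_add : theta ^ 2 + negHom theta ^ 2 = 2 * sqHom theta ^ 2 := by
  refine sub_eq_zero.mp (eq_zero_of_eq_mul_sqHom ?_)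
  simp only [map_sub, map_add, map_mul, map_pow, map_ofNat]
  linear_combination (theta + negHom theta + 2 * sqHom (sqHom theta)) * theta_add_negHom -
    2 * theta_mul_negHom

theorem sqHom_theta_sq_add :
    sqHom theta ^ 2 + sqHom (negHom theta) ^ 2 = 2 * sqHom (sqHom theta) ^ 2 := by
  simpa only [map_add, map_mul, map_pow, map_ofNat] using congrArg sqHom theta_sq_add

theorem theta_sq_sub :
    (theta ^ 2 - negHom theta ^ 2) * eulerAt 4 ^ 2 = 8 * X * eulerAt 8 ^ 4 := by
  have hX : X ∣ theta ^ 2 - negHom theta ^ 2 := by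
    rw [X_dvd_iff, map_sub, map_pow, map_pow, constantCoeff_negHom, sub_self]
  obtain ⟨k, hk⟩ := hX
  set m : ℤ⟦X⟧ := 8 * eulerAt 8 ^ 4 * eulerInv 4 ^ 2 with hm
  have h4 := eulerAt_mul_eulerInv 4
  have h8 := eulerAt_mul_eulerInv 8
  have hm4 : m * eulerAt 4 ^ 2 = 8 * eulerAt 8 ^ 4 := by
    rw [hm]
    linear_combination 8 * eulerAt 8 ^ 4 * (eulerAt 4 * eulerInv 4 + 1) * h4
  have hsm : sqHom m * eulerAt 8 ^ 2 = 8 * eulerAt 16 ^ 4 := by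
    simpa only [map_mul, map_pow, map_ofNat, sqHom_eulerAt 4 8 rfl, sqHom_eulerAt 8 16 rfl]
      using congrArg sqHom hm4
  have hsk : sqHom theta ^ 2 - sqHom (negHom theta) ^ 2 = X ^ 2 * sqHom k := by
    simpa only [map_sub, map_mul, map_pow, sqHom_X] using congrArg sqHom hk
  have hk2 : k ^ 2 = 8 * sqHom (sqHom theta) ^ 2 * sqHom k := by
    refine mul_left_cancel₀ (pow_ne_zero 2 X_ne_zero) ?_
    linear_combination (-X * k - theta ^ 2 + negHom theta ^ 2) * hk +
      (theta ^ 2 + negHom theta ^ 2 + 2 * sqHom theta ^ 2) * theta_sq_add -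
      4 * (theta * negHom theta + sqHom (negHom theta) ^ 2) * theta_mul_negHom +
      4 * (sqHom theta ^ 2 - sqHom (negHom theta) ^ 2) * sqHom_theta_sq_add +
      8 * sqHom (sqHom theta) ^ 2 * hsk
  have hm2 : m ^ 2 = 8 * sqHom (sqHom theta) ^ 2 * sqHom m := by
    have hne : eulerAt 4 ^ 4 * eulerAt 16 ^ 4 * eulerAt 8 ^ 2 ≠ 0 :=
      mul_ne_zero (mul_ne_zero (pow_ne_zero _ (eulerAt_ne_zero 4))
        (pow_ne_zero _ (eulerAt_ne_zero 16))) (pow_ne_zero _ (eulerAt_ne_zero 8))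
    refine mul_right_cancel₀ hne ?_
    have hg := sqHom_sqHom_theta_mul'
    set g := sqHom (sqHom theta)
    linear_combination (eulerAt 16 ^ 4 * eulerAt 8 ^ 2) *
      (m * eulerAt 4 ^ 2 + 8 * eulerAt 8 ^ 4) * hm4 -
      8 * (g * (eulerAt 4 ^ 2 * eulerAt 16 ^ 2) + eulerAt 8 ^ 5) *
        (sqHom m * eulerAt 8 ^ 2) * hg - 8 * eulerAt 8 ^ 10 * hsm
  have hmc : constantCoeff m = 8 := by
    have := congrArg constantCoeff hm4
    simpa [constantCoeff_eulerAt, map_ofNat (constantCoeff (R := ℤ)) 8] using this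
  have hkc : constantCoeff k = 8 := by
    have h1 := congrArg (coeff 1) hk
    rw [show theta ^ 2 - negHom theta ^ 2 =
      (theta - negHom theta) * (theta + negHom theta) by ring, coeff_one_mul, coeff_one_mul,
      map_sub, map_sub, map_add, map_add, constantCoeff_negHom, ← negArg_eq, coeff_negArg,
      ← coeff_zero_eq_constantCoeff_apply, coeff_theta, coeff_theta] at h1
    simp at h1
    omega
  have : k = m := by
    refine eq_of_sq_mul_sqHom ?_ (hkc.trans hmc.symm) (by omega)
    rw [hk2, hm2]
    ring
  rw [hk, this]
  linear_combination X * hm4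

end ThetaRelations

section G8Relations

theorem G8_mul : G8 * (eulerAt 4 ^ 2 * eulerAt 1 ^ 4) = X * (eulerAt 8 ^ 4 * eulerAt 2 ^ 2) := by
  have h4 : (eulerAt 4 * eulerInv 4) ^ 2 = 1 := by rw [eulerAt_mul_eulerInv, one_pow]
  have h1 : (eulerAt 1 * eulerInv 1) ^ 4 = 1 := by rw [eulerAt_mul_eulerInv, one_pow]
  rw [G8]
  linear_combination X * (eulerAt 8 ^ 4 * eulerAt 2 ^ 2) * ((eulerAt 1 * eulerInv 1) ^ 4 * h4 + h1)

theorem negHom_theta_sq_mul : negHom theta ^ 2 * (1 + 8 * G8) = theta ^ 2 := by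
  have hne : eulerAt 4 ^ 2 * eulerAt 2 ^ 2 ≠ 0 :=
    mul_ne_zero (pow_ne_zero _ (eulerAt_ne_zero 4)) (pow_ne_zero _ (eulerAt_ne_zero 2))
  refine mul_right_cancel₀ hne ?_
  linear_combination (-eulerAt 2 ^ 2) * theta_sq_sub + 8 * G8_mul +
    8 * G8 * eulerAt 4 ^ 2 * (negHom theta * eulerAt 2 + eulerAt 1 ^ 2) * negHom_theta_mul

theorem theta_sq_mul : theta ^ 2 * (1 + 8 * negHom G8) = negHom theta ^ 2 := by
  simpa only [map_add, map_mul, map_pow, map_ofNat, map_one, negHom_negHom] using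
    congrArg negHom negHom_theta_sq_mul

theorem sqHom_negHom_theta_sq_mul :
    sqHom (negHom theta) ^ 2 * (1 + 8 * sqHom G8) = sqHom theta ^ 2 := by
  simpa only [map_add, map_mul, map_pow, map_ofNat, map_one] using
    congrArg sqHom negHom_theta_sq_mul

theorem constantCoeff_theta : constantCoeff theta = 1 := by
  rw [← coeff_zero_eq_constantCoeff_apply, coeff_theta, if_pos rfl]

theorem theta_ne_zero : theta ≠ 0 := fun h => by
  have := constantCoeff_theta
  simp [h] at this

theorem negHom_theta_ne_zero : negHom theta ≠ 0 := fun h => by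
  have := constantCoeff_negHom theta
  simp [h, constantCoeff_theta] at this

theorem sqHom_negHom_theta_ne_zero : sqHom (negHom theta) ≠ 0 := fun h => by
  have := constantCoeff_sqHom (negHom theta)
  simp [h, constantCoeff_negHom, constantCoeff_theta] at this

end G8Relations

section U2Action

instance : CharZero ℤ⟦X⟧ := charZero_of_injective_ringHom (C_injective (R := ℤ))

theorem negHom_Phi2_mul_theta : negArg Phi2 * theta = 1 := by
  have h1 := congrArg negHom (eulerAt_mul_eulerInv 1)
  rw [map_mul, map_one] at h1
  have h2 := theta_mul
  rw [negArg_eq, Phi2, map_mul, map_pow, negHom_eulerAt 2 dvd_rfl]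
  linear_combination (negHom (eulerInv 1)) ^ 2 * h2 +
    (negHom (eulerAt 1) * negHom (eulerInv 1) + 1) * h1

theorem Phi2_mul_negHom_theta : Phi2 * negHom theta = 1 := by
  have := congrArg negHom negHom_Phi2_mul_theta
  rwa [map_mul, map_one, negArg_eq, negHom_negHom] at this

theorem sqHom_negArg_Phi2_mul : sqArg (negArg Phi2) * sqHom theta = 1 := by
  rw [sqArg_eq, ← map_mul, negHom_Phi2_mul_theta, map_one]

theorem U2_eq_of_add_negHom {F H : ℤ⟦X⟧} (h : F + negHom F = 2 * sqHom H) : U2 F = H := by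
  ext n
  have hn := congrArg (coeff (2 * n)) h
  rw [show (2 : ℤ⟦X⟧) = C 2 from rfl, coeff_C_mul, map_add, ← negArg_eq, coeff_negArg,
    ← sqArg_eq, coeff_two_mul_sqArg, pow_mul, neg_one_sq, one_pow] at hn
  rw [U2, coeff_mk]
  omega

theorem two_mul_sqHom_U2 (F : ℤ⟦X⟧) : 2 * sqHom (U2 F) = F + negHom F := by
  ext n
  rw [show (2 : ℤ⟦X⟧) = C 2 from rfl, coeff_C_mul, map_add, ← negArg_eq, coeff_negArg,
    ← sqArg_eq, coeff_sqArg]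
  split_ifs with h
  · rw [U2, coeff_mk, Nat.mul_div_cancel' h, (even_iff_two_dvd.mpr h).neg_one_pow]
    ring
  · rw [← even_iff_two_dvd, Nat.not_even_iff_odd] at h
    rw [h.neg_one_pow]
    ring

theorem U2_sqHom_mul (F H : ℤ⟦X⟧) : U2 (sqHom F * H) = F * U2 H := by
  apply U2_eq_of_add_negHom
  rw [map_mul, map_mul, negHom_sqHom]
  linear_combination -sqHom F * two_mul_sqHom_U2 H

theorem U2_add (F H : ℤ⟦X⟧) : U2 (F + H) = U2 F + U2 H := by
  ext n; simp [U2]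

theorem G8_add_negHom : G8 + negHom G8 = 8 * (sqHom G8 + 4 * sqHom G8 ^ 2) := by
  have h1 := negHom_theta_sq_mul
  have h2 := theta_sq_mul
  have h3 := theta_sq_add
  have h4 := theta_mul_negHom
  have h5 := sqHom_negHom_theta_sq_mul
  set a := theta
  set b := negHom theta
  set c := sqHom theta
  set d := sqHom b
  set x := G8
  set x' := negHom G8
  set y := sqHom G8
  have hne : 8 * d ^ 4 ≠ 0 := by
    refine mul_ne_zero ?_ (pow_ne_zero _ sqHom_negHom_theta_ne_zero)
    exact OfNat.ofNat_ne_zero 8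
  refine mul_right_cancel₀ hne ?_
  have e1 : d ^ 4 * (1 + 8 * x) = a ^ 4 := by
    linear_combination a ^ 2 * h1 - (1 + 8 * x) * (a * b + d ^ 2) * h4
  have e2 : d ^ 4 * (1 + 8 * x') = b ^ 4 := by
    linear_combination b ^ 2 * h2 - (1 + 8 * x') * (a * b + d ^ 2) * h4
  linear_combination e1 + e2 + (a ^ 2 + b ^ 2 + 2 * c ^ 2) * h3 - 2 * (a * b + d ^ 2) * h4 -
    4 * (d ^ 2 * (1 + 8 * y) + c ^ 2) * h5

theorem G8_mul_negHom : G8 * negHom G8 = -(sqHom G8 + 4 * sqHom G8 ^ 2) := by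
  have h0 := G8_add_negHom
  have h1 := negHom_theta_sq_mul
  have h2 := theta_sq_mul
  have hne : 64 * (theta ^ 2 * negHom theta ^ 2) ≠ 0 := by
    refine mul_ne_zero ?_ (mul_ne_zero (pow_ne_zero _ theta_ne_zero)
      (pow_ne_zero _ negHom_theta_ne_zero))
    exact OfNat.ofNat_ne_zero 64
  refine mul_right_cancel₀ hne ?_
  linear_combination theta ^ 2 * (1 + 8 * negHom G8) * h1 + theta ^ 2 * h2 -
    8 * theta ^ 2 * negHom theta ^ 2 * h0

theorem G8_sq :
    G8 ^ 2 = sqHom (G8 + 4 * G8 ^ 2) * (8 * G8 + 1) := by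
  simp only [map_add, map_mul, map_pow, map_ofNat]
  linear_combination G8 * G8_add_negHom - G8_mul_negHom

theorem sqHom_sqHom_theta_sq :
    sqHom (sqHom theta) ^ 2 = sqHom (negHom theta) ^ 2 * (1 + 4 * sqHom G8) := by
  refine mul_left_cancel₀ (two_ne_zero : (2 : ℤ⟦X⟧) ≠ 0) ?_
  linear_combination -sqHom_theta_sq_add - sqHom_negHom_theta_sq_mul

theorem U2_one : U2 1 = 1 := U2_eq_of_add_negHom (by simp only [map_one]; ring)

theorem U2_G8 : U2 G8 = 4 * (G8 + 4 * G8 ^ 2) := by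
  apply U2_eq_of_add_negHom
  simp only [map_add, map_mul, map_pow, map_ofNat]
  linear_combination G8_add_negHom

theorem U2_Phi2 : U2 (negArg Phi2) = sqArg (negArg Phi2) * (1 + 4 * G8) := by
  apply U2_eq_of_add_negHom
  have ha := negHom_Phi2_mul_theta
  have hb := Phi2_mul_negHom_theta
  have hg := congrArg sqHom sqHom_negArg_Phi2_mul
  have hs := theta_add_negHom
  have hd := theta_mul_negHom
  have hx := sqHom_sqHom_theta_sq
  simp only [map_add, map_mul, map_ofNat, map_one, sqArg_eq] at hg ⊢
  rw [negArg_eq] at ha hg ⊢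
  rw [negHom_negHom]
  set a := theta
  set b := negHom theta
  set g := sqHom (sqHom a)
  set p := negHom Phi2
  set r := sqHom (sqHom p)
  refine mul_right_cancel₀ (mul_ne_zero theta_ne_zero negHom_theta_ne_zero) ?_
  linear_combination b * ha + a * hb + hs - 2 * r * (1 + 4 * sqHom G8) * hd + 2 * r * hx -
    2 * g * hg

theorem U2_Phi2_mul_G8 :
    U2 (negArg Phi2 * G8) = sqArg (negArg Phi2) * (2 * (G8 + 4 * G8 ^ 2)) := by
  apply U2_eq_of_add_negHom
  have ha := negHom_Phi2_mul_theta
  have hb := Phi2_mul_negHom_theta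
  have hg := congrArg sqHom sqHom_negArg_Phi2_mul
  have hs := theta_add_negHom
  have hd := theta_mul_negHom
  have hq := theta_sq_add
  have h1 := negHom_theta_sq_mul
  have h2 := theta_sq_mul
  have h5 := sqHom_negHom_theta_sq_mul
  have hx := sqHom_sqHom_theta_sq
  simp only [map_add, map_mul, map_pow, map_ofNat, map_one, sqArg_eq] at hg ⊢
  rw [negArg_eq] at ha hg ⊢
  rw [negHom_negHom]
  set a := theta
  set b := negHom theta
  set c := sqHom a
  set d := sqHom b
  set g := sqHom c
  set p := negHom Phi2
  set r := sqHom (sqHom p)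
  set x := G8
  set x' := negHom G8
  set y := sqHom G8
  have hne : 8 * (a ^ 2 * b ^ 2) ≠ 0 := by
    refine mul_ne_zero ?_ (mul_ne_zero (pow_ne_zero _ theta_ne_zero)
      (pow_ne_zero _ negHom_theta_ne_zero))
    exact OfNat.ofNat_ne_zero 8
  refine mul_right_cancel₀ hne ?_
  have e1 : (p * x + Phi2 * x') * (8 * (a ^ 2 * b ^ 2)) = (a - b) ^ 2 * (a + b) := by
    linear_combination 8 * x * a * b ^ 2 * ha + 8 * x' * a ^ 2 * b * hb + a * h1 + b * h2
  have e2 : (a - b) ^ 2 = 16 * d ^ 2 * y := by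
    linear_combination hq - 2 * hd - 2 * h5
  have e3 : r * (1 + 4 * y) * d ^ 2 = g := by
    linear_combination g * hg - r * hx
  linear_combination e1 + (a + b) * e2 + 16 * d ^ 2 * y * hs - 32 * d ^ 2 * y * e3 -
    32 * r * y * (1 + 4 * y) * (a * b + d ^ 2) * hd

end U2Action

section Recurrence

/-- The sequence with initial values `r₀`, `r₁` and
`r (n + 2) = (X + 4 X²) (8 r (n + 1) + r n)`. -/
noncomputable def recSeq (r₀ r₁ : ℤ⟦X⟧) : ℕ → ℤ⟦X⟧
  | 0 => r₀
  | 1 => r₁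
  | n + 2 => (X + 4 * X ^ 2) * (8 * recSeq r₀ r₁ (n + 1) + recSeq r₀ r₁ n)

variable {r₀ r₁ : ℤ⟦X⟧}

theorem X_pow_dvd_recSeq (h : X ∣ r₁) : ∀ n, X ^ ((n + 1) / 2) ∣ recSeq r₀ r₁ n
  | 0 => by simp
  | 1 => by simpa [recSeq] using h
  | n + 2 => by
    have h1 := X_pow_dvd_recSeq h (n + 1)
    have h0 := X_pow_dvd_recSeq h n
    rw [recSeq, show (n + 2 + 1) / 2 = (n + 1) / 2 + 1 by omega, pow_succ']
    refine mul_dvd_mul ⟨1 + 4 * X, by ring⟩ (dvd_add (Dvd.dvd.mul_left ?_ _) h0)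
    exact (pow_dvd_pow X (by omega)).trans h1

theorem dvd_coeff_of_mem_range_rescale {r : ℤ} {f : ℤ⟦X⟧} (h : f ∈ (rescale r).range) (j : ℕ) :
    r ^ j ∣ coeff j f := by
  obtain ⟨g, rfl⟩ := h
  rw [coeff_rescale]
  exact dvd_mul_right _ _

theorem four_mul_X_mem : (4 * X : ℤ⟦X⟧) ∈ (rescale (4 : ℤ)).range :=
  ⟨X, by rw [rescale_X]; rfl⟩

theorem four_mul_weight_mem : (4 * (X + 4 * X ^ 2) : ℤ⟦X⟧) ∈ (rescale (4 : ℤ)).range := by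
  rw [show (4 * (X + 4 * X ^ 2) : ℤ⟦X⟧) = 4 * X + (4 * X) ^ 2 by ring]
  exact add_mem four_mul_X_mem (pow_mem four_mul_X_mem 2)

theorem two_pow_mul_recSeq_mem (h₀ : r₀ ∈ (rescale (4 : ℤ)).range)
    (h₁ : 2 * r₁ ∈ (rescale (4 : ℤ)).range) :
    ∀ n, 2 ^ n * recSeq r₀ r₁ n ∈ (rescale (4 : ℤ)).range
  | 0 => by simpa [recSeq] using h₀
  | 1 => by simpa only [pow_one, recSeq] using h₁
  | n + 2 => by
    have e : 2 ^ (n + 2) * recSeq r₀ r₁ (n + 2) = 4 * (X + 4 * X ^ 2) *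
        (4 * (2 ^ (n + 1) * recSeq r₀ r₁ (n + 1)) + 2 ^ n * recSeq r₀ r₁ n) := by
      rw [recSeq]; ring
    rw [e]
    exact mul_mem four_mul_weight_mem (add_mem (mul_mem (ofNat_mem _ 4)
      (two_pow_mul_recSeq_mem h₀ h₁ (n + 1))) (two_pow_mul_recSeq_mem h₀ h₁ n))

theorem four_pow_dvd_coeff_recSeq (h₀ : r₀ ∈ (rescale (4 : ℤ)).range)
    (h₁ : 2 * r₁ ∈ (rescale (4 : ℤ)).range) (n j : ℕ) :
    4 ^ j ∣ 2 ^ n * coeff j (recSeq r₀ r₁ n) := by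
  have := dvd_coeff_of_mem_range_rescale (two_pow_mul_recSeq_mem h₀ h₁ n) j
  rwa [show (2 ^ n * recSeq r₀ r₁ n : ℤ⟦X⟧) = C (2 ^ n) * recSeq r₀ r₁ n by
    rw [map_pow]; rfl, coeff_C_mul] at this

/-- The series `∑ aₙ rₙ` for `f = ∑ aₙ Xⁿ` and `r = recSeq r₀ r₁`. -/
noncomputable def recTransform (r₀ r₁ f : ℤ⟦X⟧) : ℤ⟦X⟧ :=
  ∑' n, coeff n f • recSeq r₀ r₁ n

theorem coeff_recSeq_eq_zero (h : X ∣ r₁) {n j : ℕ} (hj : 2 * j < n) :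
    coeff j (recSeq r₀ r₁ n) = 0 :=
  X_pow_dvd_iff.mp (X_pow_dvd_recSeq h n) j (by omega)

theorem hasSum_recTransform (h : X ∣ r₁) (f : ℤ⟦X⟧) :
    HasSum (fun n => coeff n f • recSeq r₀ r₁ n) (recTransform r₀ r₁ f) := by
  refine Summable.hasSum ((WithPiTopology.summable_iff_summable_coeff _).mpr fun j => ?_)
  refine summable_of_hasFiniteSupport ((Set.finite_Iic (2 * j)).subset fun n hn => ?_)
  by_contra hlt
  refine hn ?_
  simp only [map_zsmul, coeff_recSeq_eq_zero h (not_le.mp hlt), smul_zero]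

theorem dvd_coeff_recTransform (h : X ∣ r₁) (f : ℤ⟦X⟧) (j : ℕ) {a d : ℤ}
    (hd : ∀ n, d ∣ a * (coeff n f * coeff j (recSeq r₀ r₁ n))) :
    d ∣ a * coeff j (recTransform r₀ r₁ f) := by
  have hs := (WithPiTopology.hasSum_iff_hasSum_coeff _).mp (hasSum_recTransform (r₀ := r₀) h f) j
  have hfin : ∀ n ∉ Finset.range (2 * j + 1), coeff j (coeff n f • recSeq r₀ r₁ n) = 0 := by
    intro n hn
    rw [Finset.mem_range] at hn
    simp only [map_zsmul, coeff_recSeq_eq_zero h (show 2 * j < n by omega), smul_zero]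
  rw [hs.unique (hasSum_sum_of_ne_finset_zero hfin), Finset.mul_sum]
  refine Finset.dvd_sum fun n _ => ?_
  simpa only [map_zsmul, smul_eq_mul] using hd n

theorem coeff_zero_recTransform (h : X ∣ r₁) {f : ℤ⟦X⟧} (hf : coeff 0 f = 0) :
    coeff 0 (recTransform r₀ r₁ f) = 0 := by
  have := dvd_coeff_recTransform (r₀ := r₀) h f 0 (a := 1) (d := 0) fun n => by
    rcases Nat.eq_zero_or_pos n with rfl | hn
    · simp [hf]
    · rw [coeff_recSeq_eq_zero h (by omega)]; simp
  simpa using this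

end Recurrence

section Substitution

theorem constantCoeff_G8 : constantCoeff G8 = 0 := by
  simp [G8]

theorem hasSubst_G8 : HasSubst G8 := HasSubst.of_constantCoeff_zero' constantCoeff_G8

/-- Substitution of `G₈` for the variable. -/
noncomputable def substG8 : ℤ⟦X⟧ →ₐ[ℤ] ℤ⟦X⟧ := substAlgHom hasSubst_G8

theorem substG8_X : substG8 X = G8 := substAlgHom_X hasSubst_G8

theorem hasSum_substG8 {x : ℕ → ℤ⟦X⟧} {S : ℤ⟦X⟧} (h : HasSum x S) :
    HasSum (fun n => substG8 (x n)) (substG8 S) := by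
  have h1 := summable_subst h.summable hasSubst_G8
  have h2 := subst_tsum h.summable hasSubst_G8
  rw [h.tsum_eq] at h2
  have h3 := h1.hasSum
  rw [← h2] at h3
  simpa only [substG8, coe_substAlgHom] using h3

theorem hasSum_coeff_smul_G8_pow (f : ℤ⟦X⟧) :
    HasSum (fun n => coeff n f • G8 ^ n) (substG8 f) := by
  have := hasSum_substG8 (hasSum_of_monomials_self f)
  have e : (fun n => substG8 (monomial n (coeff n f))) = fun n => coeff n f • G8 ^ n := by
    ext1 n
    rw [← substG8_X, ← map_pow, ← map_zsmul]
    congr 1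
    ext m
    rw [map_zsmul, coeff_monomial, coeff_X_pow]
    split_ifs <;> simp
  rwa [e] at this

theorem constantCoeff_substG8 (f : ℤ⟦X⟧) : constantCoeff (substG8 f) = constantCoeff f := by
  obtain ⟨g, hg⟩ : X ∣ f - C (constantCoeff f) := by simp [X_dvd_iff]
  have : f = C (constantCoeff f) + X * g := by rw [← hg]; ring
  rw [this]
  have hC : substG8 (C (constantCoeff f)) = C (constantCoeff f) := substG8.commutes _
  rw [map_add, map_mul, hC, substG8_X]
  simp [constantCoeff_G8]

theorem G8_ne_zero : G8 ≠ 0 := by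
  intro h
  have := G8_mul
  rw [h, zero_mul] at this
  exact mul_ne_zero X_ne_zero (mul_ne_zero (pow_ne_zero _ (eulerAt_ne_zero 8))
    (pow_ne_zero _ (eulerAt_ne_zero 2))) this.symm

theorem substG8_injective : Function.Injective substG8 := by
  refine (injective_iff_map_eq_zero _).mpr fun f hf => ?_
  by_contra hne
  rw [← X_pow_order_mul_divXPowOrder (f := f), map_mul, map_pow, substG8_X, mul_eq_zero] at hf
  rcases hf with hf | hf
  · exact pow_ne_zero _ G8_ne_zero hf
  · have := congrArg constantCoeff hf
    rw [constantCoeff_substG8, map_zero, constantCoeff_divXPowOrder_eq_zero_iff] at this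
    exact hne this

/-- `U₂` as an additive homomorphism. -/
noncomputable def U2Hom : ℤ⟦X⟧ →+ ℤ⟦X⟧ where
  toFun := U2
  map_zero' := by ext n; simp [U2]
  map_add' := U2_add

theorem continuous_U2Hom : Continuous U2Hom := by
  rw [continuous_iff_continuousAt]
  intro F
  rw [ContinuousAt, WithPiTopology.tendsto_iff_coeff_tendsto]
  intro n
  simp only [U2Hom, AddMonoidHom.coe_mk, ZeroHom.coe_mk, U2, coeff_mk]
  exact (WithPiTopology.continuous_coeff ℤ _).continuousAt

theorem U2_mul_substG8 {A B r₀ r₁ : ℤ⟦X⟧} (h : X ∣ r₁)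
    (hAB : ∀ n, U2 (A * G8 ^ n) = B * substG8 (recSeq r₀ r₁ n)) (f : ℤ⟦X⟧) :
    U2 (A * substG8 f) = B * substG8 (recTransform r₀ r₁ f) := by
  have h1 := ((hasSum_coeff_smul_G8_pow f).mul_left A).map U2Hom continuous_U2Hom
  have h2 := (hasSum_substG8 (hasSum_recTransform (r₀ := r₀) h f)).mul_left B
  have e : (U2Hom ∘ fun n => A * coeff n f • G8 ^ n) =
      fun n => B * substG8 (coeff n f • recSeq r₀ r₁ n) := by
    ext1 n
    rw [Function.comp_apply, mul_smul_comm, map_zsmul, map_zsmul, mul_smul_comm]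
    exact congrArg (coeff n f • ·) (hAB n)
  rw [e] at h1
  exact h1.unique h2

theorem U2_mul_G8_pow {A B r₀ r₁ : ℤ⟦X⟧} (h₀ : U2 A = B * substG8 r₀)
    (h₁ : U2 (A * G8) = B * substG8 r₁) :
    ∀ n, U2 (A * G8 ^ n) = B * substG8 (recSeq r₀ r₁ n)
  | 0 => by simpa [recSeq] using h₀
  | 1 => by simpa [recSeq] using h₁
  | n + 2 => by
    have e : A * G8 ^ (n + 2) = sqHom (G8 + 4 * G8 ^ 2) *
        ((8 : ℕ) • (A * G8 ^ (n + 1)) + A * G8 ^ n) := by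
      rw [nsmul_eq_mul]
      push_cast
      linear_combination A * G8 ^ n * G8_sq
    have h8 : ∀ F, U2 ((8 : ℕ) • F) = (8 : ℕ) • U2 F := fun F => map_nsmul U2Hom 8 F
    rw [e, U2_sqHom_mul, U2_add, h8, U2_mul_G8_pow h₀ h₁ (n + 1), U2_mul_G8_pow h₀ h₁ n, recSeq,
      nsmul_eq_mul]
    simp only [map_mul, map_add, map_pow, map_ofNat, substG8_X]
    push_cast
    ring

end Substitution

section Start

theorem one_add_eight_mul_G8 : (1 + 8 * G8) * eulerAt 1 ^ 4 = negHom (eulerAt 1) ^ 4 := by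
  have h1 := negHom_theta_mul
  have h2 := theta_mul
  have h3 := negHom_theta_sq_mul
  linear_combination eulerAt 2 ^ 2 * h3 -
    (1 + 8 * G8) * (negHom theta * eulerAt 2 + eulerAt 1 ^ 2) * h1 +
    (theta * eulerAt 2 + negHom (eulerAt 1) ^ 2) * h2

theorem one_add_four_mul_G8 :
    (1 + 4 * G8) * (eulerAt 1 ^ 4 * eulerAt 2 ^ 2 * eulerAt 8 ^ 4) = eulerAt 4 ^ 10 := by
  have h1 := negHom_theta_mul
  have h2 := sqHom_theta_mul'
  have h3 := negHom_theta_sq_mul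
  have h4 := theta_sq_add
  refine mul_left_cancel₀ (two_ne_zero : (2 : ℤ⟦X⟧) ≠ 0) ?_
  linear_combination eulerAt 2 ^ 4 * eulerAt 8 ^ 4 * (h3 + h4) +
    2 * (sqHom theta * (eulerAt 2 ^ 2 * eulerAt 8 ^ 2) + eulerAt 4 ^ 5) * h2 -
    (2 + 8 * G8) * eulerAt 2 ^ 2 * eulerAt 8 ^ 4 *
      (negHom theta * eulerAt 2 + eulerAt 1 ^ 2) * h1

theorem G8_add_four_mul_sq :
    (G8 + 4 * G8 ^ 2) * eulerAt 1 ^ 8 = X * eulerAt 4 ^ 8 := by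
  have hne : eulerAt 4 ^ 2 * (eulerAt 2 ^ 2 * eulerAt 8 ^ 4) ≠ 0 :=
    mul_ne_zero (pow_ne_zero _ (eulerAt_ne_zero 4)) (mul_ne_zero
      (pow_ne_zero _ (eulerAt_ne_zero 2)) (pow_ne_zero _ (eulerAt_ne_zero 8)))
  refine mul_right_cancel₀ hne ?_
  linear_combination G8 * (eulerAt 4 ^ 2 * eulerAt 1 ^ 4) * one_add_four_mul_G8 +
    eulerAt 4 ^ 10 * G8_mul

theorem negArg_G2_mul : negArg G2 * (1 + 8 * G8) ^ 4 = -(G8 + 4 * G8 ^ 2) := by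
  have hG : G2 * eulerAt 1 ^ 24 = X * eulerAt 2 ^ 24 := by
    have h1 : (eulerAt 1 * eulerInv 1) ^ 24 = 1 := by rw [eulerAt_mul_eulerInv, one_pow]
    rw [G2]
    linear_combination X * eulerAt 2 ^ 24 * h1
  have hN := congrArg negHom hG
  rw [map_mul, map_mul, map_pow, map_pow, negHom_X, negHom_eulerAt 2 dvd_rfl] at hN
  have p1 := congrArg (· ^ 4) one_add_eight_mul_G8
  have p2 := congrArg (· ^ 8) negHom_eulerAt_one
  have hn : negHom (eulerAt 1) ≠ 0 := fun h =>
    pow_ne_zero 3 (eulerAt_ne_zero 2) (by rw [← negHom_eulerAt_one, h, zero_mul, zero_mul])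
  have hne : eulerAt 1 ^ 8 * (negHom (eulerAt 1) * eulerAt 1 * eulerAt 4) ^ 8 ≠ 0 :=
    mul_ne_zero (pow_ne_zero _ (eulerAt_ne_zero 1)) (pow_ne_zero _
      (mul_ne_zero (mul_ne_zero hn (eulerAt_ne_zero 1)) (eulerAt_ne_zero 4)))
  refine mul_right_cancel₀ hne ?_
  rw [negArg_eq]
  linear_combination negHom G2 * negHom (eulerAt 1) ^ 8 * eulerAt 4 ^ 8 * p1 +
    eulerAt 4 ^ 8 * hN + X * eulerAt 4 ^ 8 * p2 +
    (negHom (eulerAt 1) * eulerAt 1 * eulerAt 4) ^ 8 * G8_add_four_mul_sq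

/-- The series `g` with `G₂(-q) = g(G₈)`, namely `-(X + 4 X²) / (1 + 8 X)⁴`. -/
noncomputable def G2Series : ℤ⟦X⟧ :=
  -(X + 4 * X ^ 2) * rescale (4 : ℤ) (invOfUnit (1 + 2 * X) 1) ^ 4

theorem one_add_eight_mul_X_mul :
    (1 + 8 * X) * rescale (4 : ℤ) (invOfUnit (1 + 2 * X) 1) = 1 := by
  have h := mul_invOfUnit (1 + 2 * X : ℤ⟦X⟧) 1 (by simp)
  have := congrArg (rescale (4 : ℤ)) h
  rw [map_mul, map_one, map_add, map_one, map_mul, map_ofNat, rescale_X] at this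
  rw [show (C 4 : ℤ⟦X⟧) = 4 from rfl] at this
  linear_combination this

theorem substG8_G2Series : substG8 G2Series = negArg G2 := by
  have h : G2Series * (1 + 8 * X) ^ 4 = -(X + 4 * X ^ 2) := by
    have := congrArg (· ^ 4) one_add_eight_mul_X_mul
    rw [G2Series]
    linear_combination -(X + 4 * X ^ 2) * this
  have h2 := congrArg substG8 h
  simp only [map_neg, map_mul, map_add, map_pow, map_ofNat, map_one, substG8_X] at h2
  have hne : (1 + 8 * G8) ^ 4 ≠ 0 := by
    refine pow_ne_zero _ fun h => ?_
    have := congrArg constantCoeff h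
    simp [constantCoeff_G8] at this
  exact mul_right_cancel₀ hne (h2.trans negArg_G2_mul.symm)

theorem X_dvd_weight : X ∣ (X + 4 * X ^ 2 : ℤ⟦X⟧) := ⟨1 + 4 * X, by ring⟩

theorem X_dvd_G2Series : X ∣ G2Series := Dvd.dvd.mul_right X_dvd_weight.neg_right _

theorem four_pow_dvd_coeff_G2Series_pow (s j : ℕ) : 4 ^ j ∣ 4 ^ s * coeff j (G2Series ^ s) := by
  have h : 4 * G2Series ∈ (rescale (4 : ℤ)).range := by
    rw [G2Series, neg_mul, mul_neg, ← mul_assoc]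
    exact neg_mem (mul_mem four_mul_weight_mem (pow_mem (RingHom.mem_range_self _ _) 4))
  have := dvd_coeff_of_mem_range_rescale (pow_mem h s) j
  rwa [mul_pow, show (4 ^ s : ℤ⟦X⟧) = C (4 ^ s) by rw [map_pow]; rfl, coeff_C_mul] at this

end Start

section Expansion

/-- The eta quotient factored out of `L s m`: `Φ₂(-q²)` for odd `m`, `Φ₂(-q)` for even `m`. -/
noncomputable def prefactor (m : ℕ) : ℤ⟦X⟧ :=
  if Even m then negArg Phi2 else sqArg (negArg Phi2)

theorem prefactor_ne_zero (m : ℕ) : prefactor m ≠ 0 := by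
  rw [prefactor]
  split_ifs
  · exact left_ne_zero_of_mul_eq_one negHom_Phi2_mul_theta
  · exact left_ne_zero_of_mul_eq_one sqHom_negArg_Phi2_mul

theorem L_succ (s m : ℕ) : L s (m + 1) = U2 (L s m) := Function.iterate_succ_apply' _ _ _

theorem exists_recSeq_even : ∃ r₀ r₁ : ℤ⟦X⟧, X ∣ r₁ ∧ r₀ ∈ (rescale (4 : ℤ)).range ∧
    2 * r₁ ∈ (rescale (4 : ℤ)).range ∧ ∀ f, U2 (negArg Phi2 * substG8 f) =
      sqArg (negArg Phi2) * substG8 (recTransform r₀ r₁ f) := by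
  have hX : X ∣ (2 * (X + 4 * X ^ 2) : ℤ⟦X⟧) := X_dvd_weight.mul_left _
  refine ⟨1 + 4 * X, 2 * (X + 4 * X ^ 2), hX, add_mem (one_mem _) four_mul_X_mem, ?_,
    U2_mul_substG8 hX (U2_mul_G8_pow ?_ ?_)⟩
  · rw [← mul_assoc, show (2 * 2 : ℤ⟦X⟧) = 4 by norm_num]
    exact four_mul_weight_mem
  · rw [U2_Phi2]
    simp only [map_add, map_mul, map_one, map_ofNat, substG8_X]
  · rw [U2_Phi2_mul_G8]
    simp only [map_add, map_mul, map_pow, map_ofNat, substG8_X]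

theorem exists_recSeq_odd : ∃ r₀ r₁ : ℤ⟦X⟧, X ∣ r₁ ∧ r₀ ∈ (rescale (4 : ℤ)).range ∧
    2 * r₁ ∈ (rescale (4 : ℤ)).range ∧ ∀ f, U2 (sqArg (negArg Phi2) * substG8 f) =
      negArg Phi2 * substG8 (recTransform r₀ r₁ f) := by
  have hX : X ∣ (4 * (X + 4 * X ^ 2) : ℤ⟦X⟧) := X_dvd_weight.mul_left _
  refine ⟨1, 4 * (X + 4 * X ^ 2), hX, one_mem _, mul_mem (ofNat_mem _ 2) four_mul_weight_mem,
    U2_mul_substG8 hX (U2_mul_G8_pow ?_ ?_)⟩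
  · rw [← mul_one (sqArg _), sqArg_eq, U2_sqHom_mul, U2_one, map_one]
  · rw [sqArg_eq, U2_sqHom_mul, U2_G8]
    simp only [map_add, map_mul, map_pow, map_ofNat, substG8_X]

theorem exists_recSeq (m : ℕ) : ∃ r₀ r₁ : ℤ⟦X⟧, X ∣ r₁ ∧ r₀ ∈ (rescale (4 : ℤ)).range ∧
    2 * r₁ ∈ (rescale (4 : ℤ)).range ∧ ∀ f, U2 (prefactor m * substG8 f) =
      prefactor (m + 1) * substG8 (recTransform r₀ r₁ f) := by
  rcases Nat.even_or_odd m with h | h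
  · simpa only [prefactor, if_pos h, if_neg (Nat.not_even_iff_odd.mpr h.add_one)] using
      exists_recSeq_even
  · simpa only [prefactor, if_pos h.add_one, if_neg (Nat.not_even_iff_odd.mpr h)] using
      exists_recSeq_odd

theorem exists_expansion (s : ℕ) (hs : 1 ≤ s) (m : ℕ) :
    ∃ f : ℤ⟦X⟧, L s (m + 1) = prefactor (m + 1) * substG8 f ∧ coeff 0 f = 0 ∧
      ∀ j, 2 ^ m * 4 ^ j ∣ 2 ^ s * coeff j f := by
  induction m with
  | zero =>
    obtain ⟨r₀, r₁, hX, h₀, h₁, hU⟩ := exists_recSeq 0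
    have hdvd : X ^ s ∣ G2Series ^ s := pow_dvd_pow_of_dvd X_dvd_G2Series s
    refine ⟨recTransform r₀ r₁ (G2Series ^ s), ?_,
      coeff_zero_recTransform hX (X_pow_dvd_iff.mp hdvd 0 hs), fun j => ?_⟩
    · rw [← hU, map_pow, substG8_G2Series, prefactor, if_pos Even.zero]
      rfl
    · rw [pow_zero, one_mul]
      refine Int.dvd_of_mul_dvd_mul_left (a := 2 ^ s) (by positivity) ?_
      rw [← mul_assoc, ← mul_pow, show (2 * 2 : ℤ) = 4 by norm_num]
      refine dvd_coeff_recTransform hX _ j fun n => ?_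
      rcases lt_or_ge n s with hn | hn
      · rw [X_pow_dvd_iff.mp hdvd n hn, zero_mul, mul_zero]
        exact dvd_zero _
      · rw [← mul_assoc]
        obtain ⟨t, ht⟩ := four_pow_dvd_coeff_G2Series_pow s n
        obtain ⟨u, hu⟩ := four_pow_dvd_coeff_recSeq h₀ h₁ n j
        rw [ht, show (4 : ℤ) ^ n = 2 ^ n * 2 ^ n by rw [← mul_pow]; norm_num,
          show (2 : ℤ) ^ n * 2 ^ n * t * coeff j (recSeq r₀ r₁ n) =
            2 ^ n * 4 ^ j * (t * u) by linear_combination 2 ^ n * t * hu]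
        exact (mul_dvd_mul_right (pow_dvd_pow 2 hn) _).mul_right _
  | succ m ih =>
    obtain ⟨f, hL, hf0, hf⟩ := ih
    obtain ⟨r₀, r₁, hX, h₀, h₁, hU⟩ := exists_recSeq (m + 1)
    refine ⟨recTransform r₀ r₁ f, by rw [L_succ, hL, hU], coeff_zero_recTransform hX hf0,
      fun j => dvd_coeff_recTransform hX _ j fun n => ?_⟩
    rcases Nat.eq_zero_or_pos n with rfl | hn
    · rw [hf0, zero_mul, mul_zero]
      exact dvd_zero _
    · rw [← mul_assoc]
      obtain ⟨t, ht⟩ := hf n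
      obtain ⟨u, hu⟩ := four_pow_dvd_coeff_recSeq h₀ h₁ n j
      rw [ht, show (4 : ℤ) ^ n = 2 ^ n * 2 ^ n by rw [← mul_pow]; norm_num,
        show (2 : ℤ) ^ m * (2 ^ n * 2 ^ n) * t * coeff j (recSeq r₀ r₁ n) =
          2 ^ (m + n) * 4 ^ j * (t * u) by linear_combination 2 ^ m * 2 ^ n * t * hu]
      exact (mul_dvd_mul_right (pow_dvd_pow 2 (by omega)) _).mul_right _

theorem hasSum_pnat_iff {f : ℤ⟦X⟧} (hf : coeff 0 f = 0) {S : ℤ⟦X⟧} :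
    HasSum (fun j : ℕ+ => coeff (j : ℕ) f • G8 ^ (j : ℕ)) S ↔ S = substG8 f := by
  have h : HasSum (fun j : ℕ+ => coeff (j : ℕ) f • G8 ^ (j : ℕ)) (substG8 f) := by
    refine (PNat.coe_injective.hasSum_iff (f := fun n : ℕ => coeff n f • G8 ^ n) ?_).mpr
      (hasSum_coeff_smul_G8_pow f)
    intro n hn
    have : n = 0 := by
      by_contra hne
      exact hn ⟨⟨n, Nat.pos_of_ne_zero hne⟩, rfl⟩
    subst this
    simp only [hf, zero_smul]
  exact ⟨fun hS => hS.unique h, fun hS => hS ▸ h⟩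

theorem hasG8Expansion_iff {P f : ℤ⟦X⟧} (hP : P ≠ 0) (hf : coeff 0 f = 0) (c : ℕ+ → ℤ) :
    HasG8Expansion (P * substG8 f) P c ↔ c = fun j : ℕ+ => coeff (j : ℕ) f := by
  constructor
  · rintro ⟨S, hS, hPS⟩
    obtain rfl := mul_left_cancel₀ hP hPS
    set g : ℤ⟦X⟧ := PowerSeries.mk fun n => if h : 0 < n then c ⟨n, h⟩ else 0 with hg
    have hc : c = fun j : ℕ+ => coeff (j : ℕ) g := by
      ext j
      rw [hg, coeff_mk, dif_pos j.pos]
      rfl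
    have hg0 : coeff 0 g = 0 := by rw [hg, coeff_mk, dif_neg (lt_irrefl 0)]
    rw [hc] at hS ⊢
    rw [substG8_injective ((hasSum_pnat_iff hg0).mp hS)]
  · rintro rfl
    exact ⟨_, (hasSum_pnat_iff hf).mpr rfl, rfl⟩

theorem lePi2_of_dvd {s m : ℕ} {j : ℕ} {a : ℤ} (h : 2 ^ m * 4 ^ j ∣ 2 ^ s * a) :
    LePi2 ((m : ℤ) + 2 * j - s) a := by
  intro ha
  have h2 : ((2 : ℕ) : ℤ) ^ (m + 2 * j) ∣ 2 ^ s * a := by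
    rw [pow_add, pow_mul]
    exact_mod_cast h
  have : Fact (Nat.Prime 2) := ⟨Nat.prime_two⟩
  rcases (padicValInt_dvd_iff _ _).mp h2 with h0 | h0
  · exact absurd h0 (mul_ne_zero (by positivity) ha)
  · rw [padicValInt.mul (by positivity) ha, show ((2 : ℤ) ^ s) = ((2 ^ s : ℕ) : ℤ) by push_cast; rfl,
      padicValInt.of_nat, padicValNat.prime_pow] at h0
    omega

theorem hasG8Expansion_L (s : ℕ) (hs : 1 ≤ s) (m : ℕ) :
    (∃! c : ℕ+ → ℤ, HasG8Expansion (L s (m + 1)) (prefactor (m + 1)) c) ∧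
      ∀ c : ℕ+ → ℤ, HasG8Expansion (L s (m + 1)) (prefactor (m + 1)) c →
        ∀ j : ℕ+, LePi2 ((m : ℤ) + 2 * (j : ℕ) - s) (c j) := by
  obtain ⟨f, hL, hf0, hf⟩ := exists_expansion s hs m
  have key := hasG8Expansion_iff (prefactor_ne_zero (m + 1)) hf0
  rw [hL]
  refine ⟨⟨_, (key _).mpr rfl, fun c hc => (key c).mp hc⟩, fun c hc j => ?_⟩
  rw [(key c).mp hc]
  exact lePi2_of_dvd (hf j)

end Expansion

end EtaU2

theorem mainTheorem2 (s α : ℕ) (hs : 1 ≤ s) (hα : 1 ≤ α) :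
    (∃! c : ℕ+ → ℤ,
      EtaU2.HasG8Expansion (EtaU2.L s (2 * α - 1)) (EtaU2.sqArg (EtaU2.negArg EtaU2.Phi2)) c) ∧
    (∃! b : ℕ+ → ℤ,
      EtaU2.HasG8Expansion (EtaU2.L s (2 * α)) (EtaU2.negArg EtaU2.Phi2) b) ∧
    (∀ c : ℕ+ → ℤ,
      EtaU2.HasG8Expansion (EtaU2.L s (2 * α - 1)) (EtaU2.sqArg (EtaU2.negArg EtaU2.Phi2)) c →
        ∀ j : ℕ+, EtaU2.LePi2 (2 * (α : ℤ) + 2 * (j : ℤ) - (s : ℤ) - 2) (c j)) ∧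
    (∀ b : ℕ+ → ℤ,
      EtaU2.HasG8Expansion (EtaU2.L s (2 * α)) (EtaU2.negArg EtaU2.Phi2) b →
        ∀ j : ℕ+, EtaU2.LePi2 (2 * (α : ℤ) + 2 * (j : ℤ) - (s : ℤ) - 1) (b j)) := by
  obtain ⟨β, rfl⟩ := Nat.exists_eq_add_of_le' hα
  obtain ⟨h1, h2⟩ := EtaU2.hasG8Expansion_L s hs (2 * β)
  obtain ⟨h3, h4⟩ := EtaU2.hasG8Expansion_L s hs (2 * β + 1)
  have hodd : ¬ Even (2 * β + 1) := Nat.not_even_iff_odd.mpr ⟨β, rfl⟩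
  have heven : Even (2 * β + 1 + 1) := ⟨β + 1, by ring⟩
  rw [EtaU2.prefactor, if_neg hodd] at h1 h2
  rw [EtaU2.prefactor, if_pos heven] at h3 h4
  rw [show 2 * (β + 1) - 1 = 2 * β + 1 by omega, show 2 * (β + 1) = 2 * β + 1 + 1 by ring]
  refine ⟨h1, h3, fun c hc j => ?_, fun b hb j => ?_⟩
  · convert h2 c hc j using 1
    push_cast
    ring
  · convert h4 b hb j using 1
    push_cast
    ring
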